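/- Let $\nu:\mathbb N\to\mathbb C$, where $\mathbb N=\{1,2,3,\dots\}$, be a multiplicative function, i.e. $\nu(1)=1$ and $\nu(mn)=\nu(m)\nu(n)$ whenever $\gcd(m,n)=1$, and assume that $|\nu(n)|\le 1$ for all $n\ge 1$. Let $1=b_1<b_2<b_3<\cdots$ be an increasing sequence of integers with $b_{k+1}-b_k\to\infty$ as $k\to\infty$, and let $P\in\mathbb R[x]$ be a nonconstant polynomial whose leading coefficient is irrational. Then $$\frac{1}{b_{K+1}}\sum_{1\le k\le K}\Bigl|\sum_{b_k\le n<b_{k+1}}e^{2\pi i P(n)}\,\nu(n)\Bigr|\longrightarrow 0\qquad\text{as }K\to\infty.$$ -/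

import Mathlib

/-! Write `e(x) = exp(2πix)`. Multiplying `e(P(n)) ν(n)` by a constant of modulus `1` on each
block turns the sum of the absolute values of the block sums into a single sum. Since the block
lengths tend to infinity, the resulting weight `w` has total variation `o(N)` on `[0, N]`.

By the Turán–Kubilius inequality a typical `n ≤ N` has about `∑ p ∈ S, 1 / p` prime divisors in a
finite set `S`, so `∑ ν(n) F(n)` can be averaged over the factorisations `n = p m`; there `ν(p)` and
`ν(m)` separate, and Cauchy–Schwarz eliminates `ν`. This is Kátai's criterion: `∑ ν(n) F(n) = o(N)`
as soon as `F(p ·)` and `F(q ·)` are asymptotically uncorrelated for distinct primes `p` and `q`.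

For `F(n) = w(n) e(P(n))` the correlation is a slowly varying weight times `e(P(q n) - P(p n))`,
whose phase has irrational leading coefficient `(q ^ d - p ^ d) a` if `P` has degree `d` and leading
coefficient `a`. Van der Corput differencing gives cancellation in such a phase uniformly over all
windows of a large fixed length, and on most of these the weight is nearly constant.
-/

open Filter Finset Topology
open scoped FourierTransform InnerProductSpace fwdDiff

lemma tendsto_zero_of_forall_le_add {α : Type*} {l : Filter α} {f : α → ℝ}
    (hf : ∀ᶠ x in l, 0 ≤ f x)
    (h : ∀ ε > 0, ∃ g : α → ℝ, Tendsto g l (𝓝 0) ∧ ∀ᶠ x in l, f x ≤ ε + g x) :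
    Tendsto f l (𝓝 0) := by
  refine tendsto_order.mpr ⟨fun a ha => hf.mono fun x hx => ha.trans_le hx, fun ε hε => ?_⟩
  obtain ⟨g, hg, hfg⟩ := h (ε / 2) (half_pos hε)
  filter_upwards [hfg, hg.eventually_lt_const (half_pos hε)] with x hfx hgx
  linarith

section SumNorms

variable {E : Type*} [SeminormedAddCommGroup E]

lemma sq_norm_sum_le_card_mul_sum_sq_norm {ι : Type*} (s : Finset ι) (f : ι → E) :
    ‖∑ i ∈ s, f i‖ ^ 2 ≤ #s * ∑ i ∈ s, ‖f i‖ ^ 2 :=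
  (pow_le_pow_left₀ (norm_nonneg _) (norm_sum_le _ _) 2).trans sq_sum_le_card_mul_sum_sq

lemma norm_sum_range_le_of_norm_le_one {u : ℕ → E} (hu : ∀ n, ‖u n‖ ≤ 1) (N : ℕ) :
    ‖∑ n ∈ range N, u n‖ ≤ N := by
  simpa using norm_sum_le_of_le (range N) fun n _ => hu n

lemma norm_sum_range_sub_sum_shift_le {u : ℕ → E} (hu : ∀ n, ‖u n‖ ≤ 1) (N h : ℕ) :
    ‖∑ n ∈ range N, u n - ∑ n ∈ range N, u (n + h)‖ ≤ 2 * h := by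
  have hsplit : ∑ n ∈ range N, u n - ∑ n ∈ range N, u (n + h) =
      ∑ n ∈ range h, u n - ∑ n ∈ range h, u (N + n) := by
    have hcomm := sum_range_add u h N
    rw [add_comm h N, sum_range_add] at hcomm
    simp only [add_comm _ h]
    exact sub_eq_sub_iff_add_eq_add.mpr hcomm
  rw [hsplit]
  exact (norm_sub_le_of_le (norm_sum_range_le_of_norm_le_one hu h)
    (norm_sum_range_le_of_norm_le_one (fun n => hu (N + n)) h)).trans_eq (two_mul _).symm

lemma norm_nsmul_sum_sub_sum_windows_le {u : ℕ → E} (hu : ∀ n, ‖u n‖ ≤ 1) (N H : ℕ) :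
    ‖H • ∑ n ∈ range N, u n - ∑ n ∈ range N, ∑ h ∈ range H, u (n + h)‖ ≤ 2 * (H : ℝ) ^ 2 := by
  have hH : ∀ h ∈ range H, ‖∑ n ∈ range N, u n - ∑ n ∈ range N, u (n + h)‖ ≤ 2 * H := by
    intro h hh
    refine (norm_sum_range_sub_sum_shift_le hu N h).trans ?_
    gcongr
    exact (mem_range.mp hh).le
  calc ‖H • ∑ n ∈ range N, u n - ∑ n ∈ range N, ∑ h ∈ range H, u (n + h)‖
      = ‖∑ h ∈ range H, (∑ n ∈ range N, u n - ∑ n ∈ range N, u (n + h))‖ := by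
        rw [sum_sub_distrib, sum_const, card_range, sum_comm]
    _ ≤ ∑ _ ∈ range H, 2 * (H : ℝ) := norm_sum_le_of_le _ hH
    _ = 2 * (H : ℝ) ^ 2 := by
        rw [sum_const, card_range, nsmul_eq_mul]
        ring

end SumNorms

section Inner

variable {𝕜 E : Type*} [RCLike 𝕜] [SeminormedAddCommGroup E] [InnerProductSpace 𝕜 E]

lemma sum_sq_norm_sum_le {ι κ : Type*} (s : Finset ι) (t : Finset κ) (f : ι → κ → E) :
    ∑ i ∈ s, ‖∑ k ∈ t, f i k‖ ^ 2 ≤ ∑ k ∈ t, ∑ l ∈ t, ‖∑ i ∈ s, ⟪f i k, f i l⟫_𝕜‖ := by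
  have hexpand : ((∑ i ∈ s, ‖∑ k ∈ t, f i k‖ ^ 2 : ℝ) : 𝕜) =
      ∑ k ∈ t, ∑ l ∈ t, ∑ i ∈ s, ⟪f i k, f i l⟫_𝕜 := by
    push_cast
    simp_rw [← inner_self_eq_norm_sq_to_K (𝕜 := 𝕜), sum_inner, inner_sum]
    rw [sum_comm]
    exact sum_congr rfl fun k _ => sum_comm
  calc ∑ i ∈ s, ‖∑ k ∈ t, f i k‖ ^ 2
      = ‖((∑ i ∈ s, ‖∑ k ∈ t, f i k‖ ^ 2 : ℝ) : 𝕜)‖ := by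
        rw [RCLike.norm_ofReal, abs_of_nonneg (by positivity)]
    _ ≤ ∑ k ∈ t, ∑ l ∈ t, ‖∑ i ∈ s, ⟪f i k, f i l⟫_𝕜‖ := by
        rw [hexpand]
        exact norm_sum_le_of_le _ fun k _ => norm_sum_le _ _

lemma norm_inner_le_one {x y : E} (hx : ‖x‖ ≤ 1) (hy : ‖y‖ ≤ 1) : ‖⟪x, y⟫_𝕜‖ ≤ 1 :=
  (norm_inner_le_norm x y).trans (mul_le_one₀ hx (norm_nonneg y) hy)

end Inner

/-- A sequence has uniform mean zero if its averages over windows of length `L` tend to zero as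
`L → ∞`, uniformly in the position of the window. The uniformity lets the cancellation survive
multiplication by a slowly varying weight. -/
def HasUniformMeanZero {E : Type*} [SeminormedAddCommGroup E] (u : ℕ → E) : Prop :=
  ∀ ε > 0, ∀ᶠ L : ℕ in atTop, ∀ a, ‖∑ l ∈ range L, u (a + l)‖ ≤ ε * L

lemma HasUniformMeanZero.comp_add {E : Type*} [SeminormedAddCommGroup E] {u : ℕ → E}
    (hu : HasUniformMeanZero u) (k : ℕ) : HasUniformMeanZero fun n => u (n + k) := fun ε hε =>
  (hu ε hε).mono fun L hL a => by simpa only [add_right_comm] using hL (a + k)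

section VanDerCorput

variable {𝕜 E : Type*} [RCLike 𝕜] [SeminormedAddCommGroup E] [InnerProductSpace 𝕜 E] {u : ℕ → E}

lemma norm_sum_inner_comm {ι : Type*} (s : Finset ι) (f g : ι → E) :
    ‖∑ i ∈ s, ⟪f i, g i⟫_𝕜‖ = ‖∑ i ∈ s, ⟪g i, f i⟫_𝕜‖ := by
  rw [← RCLike.norm_conj, map_sum]
  simp_rw [inner_conj_symm]

lemma sq_norm_sum_windows_le (hu : ∀ n, ‖u n‖ ≤ 1) {N H : ℕ} {δ : ℝ} (hδ : 0 ≤ δ)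
    (hcorr : ∀ h < H, ∀ k < h, ‖∑ n ∈ range N, ⟪u (n + k), u (n + h)⟫_𝕜‖ ≤ δ * N) :
    ‖∑ n ∈ range N, ∑ h ∈ range H, u (n + h)‖ ^ 2 ≤ (N : ℝ) ^ 2 * (H + δ * H ^ 2) := by
  have hpair : ∀ h < H, ∀ k < H, ‖∑ n ∈ range N, ⟪u (n + k), u (n + h)⟫_𝕜‖ ≤
      (if h = k then (N : ℝ) else 0) + δ * N := by
    intro h hh k hk
    rcases lt_trichotomy h k with hlt | rfl | hlt
    · simpa [hlt.ne, norm_sum_inner_comm] using hcorr k hk h hlt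
    · have := norm_sum_range_le_of_norm_le_one
        (fun n => norm_inner_le_one (𝕜 := 𝕜) (hu (n + h)) (hu (n + h))) N
      simpa using this.trans (le_add_of_nonneg_right (by positivity))
    · simpa [hlt.ne'] using hcorr h hh k hlt
  calc ‖∑ n ∈ range N, ∑ h ∈ range H, u (n + h)‖ ^ 2
      ≤ N * ∑ n ∈ range N, ‖∑ h ∈ range H, u (n + h)‖ ^ 2 := by
        simpa using sq_norm_sum_le_card_mul_sum_sq_norm (range N) fun n => ∑ h ∈ range H, u (n + h)
    _ ≤ N * ∑ k ∈ range H, ∑ h ∈ range H, ‖∑ n ∈ range N, ⟪u (n + k), u (n + h)⟫_𝕜‖ := by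
        gcongr
        exact sum_sq_norm_sum_le _ _ _
    _ ≤ N * ∑ k ∈ range H, ∑ h ∈ range H, ((if h = k then (N : ℝ) else 0) + δ * N) := by
        gcongr with k hk h hh
        exact hpair h (mem_range.mp hh) k (mem_range.mp hk)
    _ = (N : ℝ) ^ 2 * (H + δ * H ^ 2) := by
        have hrow : ∀ k ∈ range H, ∑ h ∈ range H, ((if h = k then (N : ℝ) else 0) + δ * N) =
            N + H * (δ * N) := fun k hk => by
          rw [sum_add_distrib, sum_ite_eq', if_pos hk, sum_const, card_range, nsmul_eq_mul]
        rw [sum_congr rfl hrow, sum_const, card_range, nsmul_eq_mul]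
        ring

lemma van_der_corput_inequality (hu : ∀ n, ‖u n‖ ≤ 1) {N H : ℕ} {δ : ℝ} (hδ : 0 ≤ δ)
    (hcorr : ∀ h < H, ∀ k < h, ‖∑ n ∈ range N, ⟪u (n + k), u (n + h)⟫_𝕜‖ ≤ δ * N) :
    H * ‖∑ n ∈ range N, u n‖ ≤ N * √(H + δ * H ^ 2) + 2 * (H : ℝ) ^ 2 := by
  have hwindows : ‖∑ n ∈ range N, ∑ h ∈ range H, u (n + h)‖ ≤ N * √(H + δ * H ^ 2) := by
    refine (Real.le_sqrt_of_sq_le (sq_norm_sum_windows_le hu hδ hcorr)).trans_eq ?_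
    rw [Real.sqrt_mul (by positivity), Real.sqrt_sq (by positivity)]
  calc H * ‖∑ n ∈ range N, u n‖ = ‖H • ∑ n ∈ range N, u n‖ := by
        rw [← Nat.cast_smul_eq_nsmul 𝕜, norm_smul, RCLike.norm_natCast]
    _ ≤ ‖∑ n ∈ range N, ∑ h ∈ range H, u (n + h)‖ +
        ‖H • ∑ n ∈ range N, u n - ∑ n ∈ range N, ∑ h ∈ range H, u (n + h)‖ :=
      norm_le_norm_add_norm_sub' _ _
    _ ≤ N * √(H + δ * H ^ 2) + 2 * (H : ℝ) ^ 2 :=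
      add_le_add hwindows (norm_nsmul_sum_sub_sum_windows_le hu N H)

theorem HasUniformMeanZero.of_inner (hu : ∀ n, ‖u n‖ ≤ 1)
    (hcorr : ∀ h > 0, HasUniformMeanZero fun n => ⟪u n, u (n + h)⟫_𝕜) : HasUniformMeanZero u := by
  intro ε hε
  obtain ⟨H, hH⟩ := exists_nat_gt (8 / ε ^ 2)
  have hH0 : (0 : ℝ) < H := lt_trans (by positivity) hH
  set δ : ℝ := ε ^ 2 / 8 with hδ
  have hδ0 : 0 < δ := by positivity
  have hsqrt : √(H + δ * H ^ 2) ≤ ε / 2 * H := by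
    refine Real.sqrt_le_iff.mpr ⟨by positivity, ?_⟩
    rw [div_lt_iff₀ (by positivity)] at hH
    nlinarith
  filter_upwards [(eventually_all_finset (Ioo 0 H)).mpr
      fun h hh => hcorr h (mem_Ioo.mp hh).1 δ hδ0,
    tendsto_natCast_atTop_atTop.eventually_ge_atTop (4 * H / ε)] with L hcorrL hL a
  have hshift : ∀ h < H, ∀ k < h,
      ‖∑ n ∈ range L, ⟪u (a + (n + k)), u (a + (n + h))⟫_𝕜‖ ≤ δ * L := by
    intro h hh k hk
    obtain ⟨j, rfl⟩ := Nat.exists_eq_add_of_lt hk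
    have hle := hcorrL (j + 1) (mem_Ioo.mpr (by omega)) (a + k)
    have hindex : ∀ n, u (a + (n + (k + j + 1))) = u (a + k + n + (j + 1)) := fun n => by
      congr 1; omega
    simpa only [hindex, add_comm _ k, ← add_assoc] using hle
  have hvdc := van_der_corput_inequality (fun n => hu (a + n)) hδ0.le hshift
  rw [div_le_iff₀ hε] at hL
  have hbound : (H : ℝ) * ‖∑ l ∈ range L, u (a + l)‖ ≤ H * (ε * L) :=
    calc (H : ℝ) * ‖∑ l ∈ range L, u (a + l)‖ ≤ L * (ε / 2 * H) + 2 * (H : ℝ) ^ 2 :=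
          hvdc.trans (by gcongr)
      _ ≤ H * (ε * L) := by nlinarith
  exact le_of_mul_le_mul_left hbound hH0

end VanDerCorput

section Weyl

lemma norm_fourierChar (x : ℝ) : ‖(𝐞 x : ℂ)‖ = 1 := Circle.norm_coe _

lemma inner_fourierChar (x y : ℝ) : ⟪(𝐞 x : ℂ), (𝐞 y : ℂ)⟫_ℂ = 𝐞 (y - x) := by
  rw [RCLike.inner_apply, ← Circle.coe_inv_eq_conj, ← Circle.coe_mul, AddChar.map_sub_eq_div,
    div_eq_mul_inv]

lemma fourierChar_ne_one_of_irrational {x : ℝ} (hx : Irrational x) : (𝐞 x : ℂ) ≠ 1 := by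
  rw [Real.fourierChar_apply, Ne, Complex.exp_eq_one_iff]
  rintro ⟨n, hn⟩
  have hxn : (x : ℂ) = n := by
    refine mul_left_cancel₀ Complex.two_pi_I_ne_zero ?_
    push_cast at hn
    linear_combination hn
  exact hx.ne_int n (by exact_mod_cast hxn)

lemma eq_add_nsmul_of_fwdDiff_eq {G : Type*} [AddCommGroup G] {g : ℕ → G} {β : G}
    (hg : ∀ n, Δ_[1] g n = β) (n h : ℕ) : g (n + h) = g n + h • β := by
  induction h with
  | zero => simp
  | succ h ih =>
    rw [succ_nsmul, ← add_assoc (g n), ← ih, ← hg (n + h), fwdDiff, add_sub_cancel, add_assoc]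

lemma fwdDiff_iter_sub {M G : Type*} [AddCommMonoid M] [AddCommGroup G] (h : M) (f g : M → G)
    (n : ℕ) : Δ_[h] ^[n] (f - g) = Δ_[h] ^[n] f - Δ_[h] ^[n] g := by
  have := fwdDiff_iter_add h (f - g) g n
  rw [sub_add_cancel] at this
  exact eq_sub_of_add_eq this.symm

lemma fwdDiff_iter_shift_sub {G : Type*} [AddCommGroup G] {f : ℕ → G} {β : G} {d : ℕ}
    (hf : ∀ n, Δ_[1] ^[d + 1] f n = β) (h n : ℕ) :
    Δ_[1] ^[d] (fun m => f (m + h) - f m) n = h • β := by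
  have hstep : ∀ n, Δ_[1] (Δ_[1] ^[d] f) n = β := by
    simpa only [Function.iterate_succ_apply'] using hf
  change Δ_[1] ^[d] ((fun m => f (m + h)) - f) n = h • β
  rw [fwdDiff_iter_sub, Pi.sub_apply, fwdDiff_iter_comp_add, eq_add_nsmul_of_fwdDiff_eq hstep,
    add_sub_cancel_left]

lemma norm_geom_sum_le {z : ℂ} (hz : ‖z‖ = 1) (hz1 : z ≠ 1) (L : ℕ) :
    ‖∑ l ∈ range L, z ^ l‖ ≤ 2 / ‖z - 1‖ := by
  rw [geom_sum_eq hz1, norm_div]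
  gcongr
  refine (norm_sub_le _ _).trans_eq ?_
  rw [norm_pow, hz, one_pow, norm_one, one_add_one_eq_two]

theorem hasUniformMeanZero_fourierChar_of_fwdDiff {β : ℝ} {f : ℕ → ℝ} {d : ℕ} (hβ : Irrational β)
    (hf : ∀ n, Δ_[1] ^[d + 1] f n = β) : HasUniformMeanZero fun n => (𝐞 (f n) : ℂ) := by
  induction d generalizing β f with
  | zero =>
    intro ε hε
    have hz := fourierChar_ne_one_of_irrational hβ
    filter_upwards [tendsto_natCast_atTop_atTop.eventually_ge_atTop (2 / ‖(𝐞 β : ℂ) - 1‖ / ε)]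
      with L hL a
    have hgeom : ∀ l, (𝐞 (f (a + l)) : ℂ) = 𝐞 (f a) * (𝐞 β : ℂ) ^ l := fun l => by
      rw [eq_add_nsmul_of_fwdDiff_eq hf, AddChar.map_add_eq_mul, AddChar.map_nsmul_eq_pow,
        Circle.coe_mul, Circle.coe_pow]
    simp_rw [hgeom]
    rw [← mul_sum, norm_mul, norm_fourierChar, one_mul]
    exact (norm_geom_sum_le (norm_fourierChar β) hz L).trans ((div_le_iff₀' hε).mp hL)
  | succ d ih =>
    refine HasUniformMeanZero.of_inner (𝕜 := ℂ) (fun n => (norm_fourierChar _).le) fun h hh => ?_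
    simp_rw [inner_fourierChar]
    exact ih (hβ.natCast_mul hh.ne') fun n => by
      rw [fwdDiff_iter_shift_sub hf, nsmul_eq_mul]

end Weyl

/-- A sequence varies slowly if its total variation on `[0, N]` is `o(N)`, so that it is nearly
constant on most windows of a fixed length. -/
def SlowlyVarying {E : Type*} [SeminormedAddCommGroup E] (w : ℕ → E) : Prop :=
  Tendsto (fun N : ℕ => (∑ n ∈ range N, ‖w (n + 1) - w n‖) / N) atTop (𝓝 0)

namespace SlowlyVarying

section Group

variable {E : Type*} [SeminormedAddCommGroup E] {w : ℕ → E}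

lemma star [StarAddMonoid E] [NormedStarGroup E] (hw : SlowlyVarying w) :
    SlowlyVarying fun n => star (w n) := by
  simpa only [SlowlyVarying, ← star_sub, norm_star] using hw

lemma comp_add (hw : SlowlyVarying w) (l : ℕ) : SlowlyVarying fun n => w (n + l) := by
  have h := ((tendsto_add_atTop_iff_nat l).mpr hw).const_mul (l + 1 : ℝ)
  rw [mul_zero] at h
  refine squeeze_zero (fun N => by positivity) (fun N => ?_) h
  have hsum : ∑ n ∈ range N, ‖w (n + 1 + l) - w (n + l)‖ ≤
      ∑ n ∈ range (N + l), ‖w (n + 1) - w n‖ := by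
    rw [add_comm N l, sum_range_add]
    simp only [add_right_comm _ 1 l, add_comm l]
    exact le_add_of_nonneg_left (by positivity)
  rcases N.eq_zero_or_pos with rfl | hN
  · simp only [range_zero, sum_empty, zero_div]
    positivity
  have hN' : (1 : ℝ) ≤ N := by exact_mod_cast hN
  rw [mul_div_assoc', div_le_div_iff₀ (by positivity) (by positivity)]
  calc (∑ n ∈ range N, ‖w (n + 1 + l) - w (n + l)‖) * ↑(N + l)
      ≤ (∑ n ∈ range (N + l), ‖w (n + 1) - w n‖) * ((l + 1) * N) := by
        gcongr
        push_cast
        nlinarith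
    _ = (l + 1) * (∑ n ∈ range (N + l), ‖w (n + 1) - w n‖) * N := by ring

lemma comp_mul (hw : SlowlyVarying w) {p : ℕ} (hp : 0 < p) :
    SlowlyVarying fun n => w (p * n) := by
  have h := (hw.comp (tendsto_id.const_mul_atTop' hp)).const_mul (p : ℝ)
  rw [mul_zero] at h
  refine squeeze_zero (fun N => by positivity) (fun N => ?_) h
  have hsum : ∑ n ∈ range N, ‖w (p * (n + 1)) - w (p * n)‖ ≤
      ∑ n ∈ range (p * N), ‖w (n + 1) - w n‖ := by
    induction N with
    | zero => simp
    | succ N ih =>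
      rw [sum_range_succ, mul_add, mul_one, sum_range_add]
      refine add_le_add ih ?_
      simpa only [dist_eq_norm_sub', add_zero, ← add_assoc] using
        dist_le_range_sum_dist (fun j => w (p * N + j)) p
  simp only [Function.comp_apply, id, Nat.cast_mul]
  rw [mul_div_assoc', mul_div_mul_left _ _ (by positivity)]
  gcongr

lemma tendsto_sum_norm_shift_sub (hw : SlowlyVarying w) (l : ℕ) :
    Tendsto (fun N : ℕ => (∑ n ∈ range N, ‖w (n + l) - w n‖) / N) atTop (𝓝 0) := by
  induction l with
  | zero => simp
  | succ l ih =>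
    have h := (hw.comp_add l).add ih
    rw [add_zero] at h
    refine squeeze_zero (fun N => by positivity) (fun N => ?_) h
    rw [← add_div, ← sum_add_distrib]
    gcongr with n _
    rw [← add_assoc, add_right_comm n l 1]
    exact norm_sub_le_norm_sub_add_norm_sub _ _ _

end Group

lemma mul {R : Type*} [NonUnitalSeminormedRing R] {w v : ℕ → R} (hw : SlowlyVarying w)
    (hv : SlowlyVarying v) (hw1 : ∀ n, ‖w n‖ ≤ 1) (hv1 : ∀ n, ‖v n‖ ≤ 1) :
    SlowlyVarying fun n => w n * v n := by
  have h := Tendsto.add hw hv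
  rw [add_zero] at h
  refine squeeze_zero (fun N => by positivity) (fun N => ?_) h
  rw [← add_div, ← sum_add_distrib]
  gcongr with n _
  calc ‖w (n + 1) * v (n + 1) - w n * v n‖
      = ‖(w (n + 1) - w n) * v (n + 1) + w n * (v (n + 1) - v n)‖ := by
        rw [sub_mul, mul_sub, sub_add_sub_cancel]
    _ ≤ ‖w (n + 1) - w n‖ * ‖v (n + 1)‖ + ‖w n‖ * ‖v (n + 1) - v n‖ :=
        norm_add_le_of_le (norm_mul_le _ _) (norm_mul_le _ _)
    _ ≤ ‖w (n + 1) - w n‖ + ‖v (n + 1) - v n‖ :=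
        add_le_add (mul_le_of_le_one_right (norm_nonneg _) (hv1 _))
          (mul_le_of_le_one_left (norm_nonneg _) (hw1 _))

end SlowlyVarying

section Orthogonality

lemma sum_Ioc_zero_eq_sum_range {M : Type*} [AddCommMonoid M] (f : ℕ → M) (N : ℕ) :
    ∑ n ∈ Ioc 0 N, f n = ∑ n ∈ range N, f (n + 1) := by
  rw [range_eq_Ico, sum_Ico_add' f, Ico_add_one_add_one_eq_Ioc]

variable {𝕜 E : Type*} [RCLike 𝕜] [SeminormedAddCommGroup E] [NormedSpace 𝕜 E]
  {w : ℕ → 𝕜} {u : ℕ → E}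

lemma norm_sum_windows_smul_le (hw1 : ∀ n, ‖w n‖ ≤ 1) (hu1 : ∀ n, ‖u n‖ ≤ 1) {L : ℕ} {δ : ℝ}
    (hu : ∀ n, ‖∑ l ∈ range L, u (n + l)‖ ≤ δ) (N : ℕ) :
    ‖∑ n ∈ range N, ∑ l ∈ range L, w (n + l) • u (n + l)‖ ≤
      N * δ + ∑ l ∈ range L, ∑ n ∈ range N, ‖w (n + l) - w n‖ := by
  have hwindow : ∀ n ∈ range N, ‖∑ l ∈ range L, w (n + l) • u (n + l)‖ ≤
      δ + ∑ l ∈ range L, ‖w (n + l) - w n‖ := fun n _ =>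
    calc ‖∑ l ∈ range L, w (n + l) • u (n + l)‖
        = ‖w n • ∑ l ∈ range L, u (n + l) + ∑ l ∈ range L, (w (n + l) - w n) • u (n + l)‖ := by
          rw [smul_sum, ← sum_add_distrib]
          simp only [← add_smul, add_sub_cancel]
      _ ≤ δ + ∑ l ∈ range L, ‖w (n + l) - w n‖ := by
          refine norm_add_le_of_le ?_ (norm_sum_le_of_le _ fun l _ => ?_)
          · rw [norm_smul]
            exact (mul_le_of_le_one_left (norm_nonneg _) (hw1 n)).trans (hu n)
          · rw [norm_smul]
            exact mul_le_of_le_one_right (norm_nonneg _) (hu1 _)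
  refine (norm_sum_le_of_le _ hwindow).trans_eq ?_
  rw [sum_add_distrib, sum_const, card_range, nsmul_eq_mul, sum_comm]

theorem SlowlyVarying.tendsto_norm_sum_range_smul (hw : SlowlyVarying w) (hw1 : ∀ n, ‖w n‖ ≤ 1)
    (hu : HasUniformMeanZero u) (hu1 : ∀ n, ‖u n‖ ≤ 1) :
    Tendsto (fun N : ℕ => ‖∑ n ∈ range N, w n • u n‖ / N) atTop (𝓝 0) := by
  refine tendsto_zero_of_forall_le_add (.of_forall fun N => by positivity) fun ε hε => ?_
  obtain ⟨L, hL, hL0⟩ := ((hu ε hε).and (eventually_gt_atTop 0)).exists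
  have hL0' : (0 : ℝ) < L := by exact_mod_cast hL0
  have hwu1 : ∀ n, ‖w n • u n‖ ≤ 1 := fun n => by
    rw [norm_smul]
    exact mul_le_one₀ (hw1 n) (norm_nonneg _) (hu1 n)
  refine ⟨fun N => (∑ l ∈ range L, (∑ n ∈ range N, ‖w (n + l) - w n‖) / N) / L +
    2 * L / N, ?_, ?_⟩
  · have hshifts := tendsto_finsetSum (range L) fun l _ => hw.tendsto_sum_norm_shift_sub l
    simpa using (hshifts.div_const (L : ℝ)).add (tendsto_const_div_atTop_nhds_zero_nat (2 * L : ℝ))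
  filter_upwards [eventually_gt_atTop 0] with N hN
  have hN' : (0 : ℝ) < N := by exact_mod_cast hN
  have hbound : L * ‖∑ n ∈ range N, w n • u n‖ ≤
      N * (ε * L) + ∑ l ∈ range L, ∑ n ∈ range N, ‖w (n + l) - w n‖ + 2 * (L : ℝ) ^ 2 :=
    calc L * ‖∑ n ∈ range N, w n • u n‖ = ‖L • ∑ n ∈ range N, w n • u n‖ := by
          rw [← Nat.cast_smul_eq_nsmul 𝕜, norm_smul, RCLike.norm_natCast]
      _ ≤ _ := norm_le_norm_add_norm_sub' _ _
      _ ≤ _ := add_le_add (norm_sum_windows_smul_le hw1 hu1 hL N)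
          (norm_nsmul_sum_sub_sum_windows_le hwu1 N L)
  rw [← sum_div, div_le_iff₀ hN']
  refine le_of_mul_le_mul_left (hbound.trans_eq ?_) hL0'
  field_simp
  ring

lemma SlowlyVarying.tendsto_norm_sum_Ioc_smul (hw : SlowlyVarying w) (hw1 : ∀ n, ‖w n‖ ≤ 1)
    (hu : HasUniformMeanZero u) (hu1 : ∀ n, ‖u n‖ ≤ 1) :
    Tendsto (fun N : ℕ => ‖∑ n ∈ Ioc 0 N, w n • u n‖ / N) atTop (𝓝 0) := by
  simp_rw [sum_Ioc_zero_eq_sum_range]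
  exact (hw.comp_add 1).tendsto_norm_sum_range_smul (fun n => hw1 _) (hu.comp_add 1)
    fun n => hu1 _

end Orthogonality

section PolynomialPhases

lemma fwdDiff_iter_comp_natCast {R G : Type*} [Semiring R] [AddCommGroup G] (g : R → G) (d n : ℕ) :
    Δ_[1] ^[d] (fun m : ℕ => g m) n = Δ_[1] ^[d] g n := by
  induction d generalizing g with
  | zero => rfl
  | succ d ih =>
    rw [Function.iterate_succ_apply, Function.iterate_succ_apply, ← ih]
    congr! with m
    simp [fwdDiff]

lemma fwdDiff_iter_natDegree_eval_mul {R : Type*} [CommRing R] [NoZeroDivisors R]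
    (P : Polynomial R) {r : R} (hr : r ≠ 0) (n : ℕ) :
    Δ_[1] ^[P.natDegree] (fun m : ℕ => P.eval (r * m)) n =
      P.leadingCoeff * r ^ P.natDegree * P.natDegree.factorial := by
  have hdeg : (Polynomial.C r * Polynomial.X).natDegree = 1 := Polynomial.natDegree_C_mul_X r hr
  have h := congrFun (P.comp (.C r * .X)).fwdDiff_iter_degree_eq_factorial n
  rw [Polynomial.natDegree_comp, hdeg, mul_one, Polynomial.leadingCoeff_comp (by simp [hdeg]),
    Polynomial.leadingCoeff_C_mul_X] at h
  rw [fwdDiff_iter_comp_natCast fun x => P.eval (r * x)]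
  simpa only [Polynomial.eval_comp, Polynomial.eval_mul, Polynomial.eval_C, Polynomial.eval_X,
    Pi.smul_apply, Pi.natCast_apply, smul_eq_mul] using h

theorem hasUniformMeanZero_inner_fourierChar_eval_mul {P : Polynomial ℝ} (hdeg : 0 < P.natDegree)
    (hP : Irrational P.leadingCoeff) {p q : ℕ} (hp : p ≠ 0) (hq : q ≠ 0) (hpq : p ≠ q) :
    HasUniformMeanZero fun n : ℕ =>
      ⟪(𝐞 (P.eval ((p * n : ℕ) : ℝ)) : ℂ), (𝐞 (P.eval ((q * n : ℕ) : ℝ)) : ℂ)⟫_ℂ := by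
  obtain ⟨d, hd⟩ := Nat.exists_eq_add_one_of_ne_zero hdeg.ne'
  have hpow : (q : ℤ) ^ P.natDegree - (p : ℤ) ^ P.natDegree ≠ 0 := sub_ne_zero.mpr <| by
    exact_mod_cast fun h => hpq (Nat.pow_left_injective hdeg.ne' h).symm
  have hβ := (hP.mul_intCast hpow).mul_natCast P.natDegree.factorial_ne_zero
  simp_rw [inner_fourierChar]
  refine hasUniformMeanZero_fourierChar_of_fwdDiff hβ (d := d) fun n => ?_
  have htop := congrFun (fwdDiff_iter_sub 1 (fun m : ℕ => P.eval (q * m : ℝ))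
    (fun m : ℕ => P.eval (p * m : ℝ)) P.natDegree) n
  rw [Pi.sub_apply, fwdDiff_iter_natDegree_eval_mul P (Nat.cast_ne_zero.mpr hq),
    fwdDiff_iter_natDegree_eval_mul P (Nat.cast_ne_zero.mpr hp), ← sub_mul, ← mul_sub] at htop
  rw [← hd]
  push_cast
  exact htop

end PolynomialPhases

section TuranKubilius

variable {S : Finset ℕ}

lemma card_filter_dvd_le (N d : ℕ) : (#{n ∈ Ioc 0 N | d ∣ n} : ℝ) ≤ N / d := by
  rw [Nat.Ioc_filter_dvd_card_eq_div]
  exact Nat.cast_div_le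

lemma sub_one_le_card_filter_dvd (N d : ℕ) : (N : ℝ) / d - 1 ≤ #{n ∈ Ioc 0 N | d ∣ n} := by
  rw [Nat.Ioc_filter_dvd_card_eq_div, ← Nat.floor_div_eq_div (K := ℝ)]
  exact (Nat.sub_one_lt_floor _).le

lemma card_filter_dvd_and_dvd_le_of_coprime {p q : ℕ} (hpq : p.Coprime q) (N : ℕ) :
    (#{n ∈ Ioc 0 N | p ∣ n ∧ q ∣ n} : ℝ) ≤ N * (1 / p * (1 / q)) := by
  simp_rw [← Nat.lcm_dvd_iff, hpq.lcm_eq_mul]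
  refine (card_filter_dvd_le N (p * q)).trans_eq ?_
  rw [Nat.cast_mul, one_div_mul_one_div, mul_one_div]

lemma sum_sum_eq_sum_add_sum_offDiag {ι M : Type*} [AddCommMonoid M] (s : Finset ι)
    (f : ι → ι → M) :
    ∑ i ∈ s, ∑ j ∈ s, f i j = ∑ i ∈ s, f i i + ∑ x ∈ s.offDiag, f x.1 x.2 := by
  classical
  rw [← sum_product', ← diag_union_offDiag, sum_union (disjoint_diag_offDiag s), sum_diag]

lemma le_sum_card_filter_dvd (S : Finset ℕ) (N : ℕ) :
    (N : ℝ) * ∑ p ∈ S, (1 / p : ℝ) - #S ≤ ∑ n ∈ Ioc 0 N, (#{p ∈ S | p ∣ n} : ℝ) := by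
  have hcount : ∑ n ∈ Ioc 0 N, #{p ∈ S | p ∣ n} = ∑ p ∈ S, #{n ∈ Ioc 0 N | p ∣ n} :=
    sum_card_bipartiteAbove_eq_sum_card_bipartiteBelow fun n p => p ∣ n
  calc (N : ℝ) * ∑ p ∈ S, (1 / p : ℝ) - #S = ∑ p ∈ S, ((N : ℝ) / p - 1) := by
        simp only [mul_sum, mul_one_div, sum_sub_distrib, sum_const, nsmul_one]
    _ ≤ ∑ p ∈ S, (#{n ∈ Ioc 0 N | p ∣ n} : ℝ) :=
        sum_le_sum fun p _ => sub_one_le_card_filter_dvd N p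
    _ = ∑ n ∈ Ioc 0 N, (#{p ∈ S | p ∣ n} : ℝ) := by exact_mod_cast hcount.symm

lemma sum_sq_card_filter_dvd_eq (S : Finset ℕ) (N : ℕ) :
    ∑ n ∈ Ioc 0 N, #{p ∈ S | p ∣ n} ^ 2 =
      ∑ p ∈ S, ∑ q ∈ S, #{n ∈ Ioc 0 N | p ∣ n ∧ q ∣ n} := by
  simp only [sq, ← card_product, ← filter_product]
  rw [← sum_product']
  exact sum_card_bipartiteAbove_eq_sum_card_bipartiteBelow
    fun n (x : ℕ × ℕ) => x.1 ∣ n ∧ x.2 ∣ n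

lemma sum_sq_card_filter_dvd_le (hS : (S : Set ℕ).Pairwise Nat.Coprime) (N : ℕ) :
    ∑ n ∈ Ioc 0 N, (#{p ∈ S | p ∣ n} : ℝ) ^ 2 ≤
      N * ∑ p ∈ S, (1 / p : ℝ) + N * (∑ p ∈ S, (1 / p : ℝ)) ^ 2 := by
  calc ∑ n ∈ Ioc 0 N, (#{p ∈ S | p ∣ n} : ℝ) ^ 2
      = ∑ p ∈ S, ∑ q ∈ S, (#{n ∈ Ioc 0 N | p ∣ n ∧ q ∣ n} : ℝ) := by
        exact_mod_cast sum_sq_card_filter_dvd_eq S N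
    _ = ∑ p ∈ S, (#{n ∈ Ioc 0 N | p ∣ n} : ℝ) +
        ∑ x ∈ S.offDiag, (#{n ∈ Ioc 0 N | x.1 ∣ n ∧ x.2 ∣ n} : ℝ) := by
        simp only [sum_sum_eq_sum_add_sum_offDiag, and_self]
    _ ≤ ∑ p ∈ S, (N * (1 / p) : ℝ) + ∑ x ∈ S.offDiag, (N * (1 / x.1 * (1 / x.2)) : ℝ) := by
        refine add_le_add (sum_le_sum fun p _ => ?_) (sum_le_sum fun x hx => ?_)
        · exact (card_filter_dvd_le N p).trans_eq (mul_one_div _ _).symm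
        · obtain ⟨hp, hq, hpq⟩ := mem_offDiag.mp hx
          exact card_filter_dvd_and_dvd_le_of_coprime (hS hp hq hpq) N
    _ ≤ ∑ p ∈ S, (N * (1 / p) : ℝ) + ∑ x ∈ S ×ˢ S, (N * (1 / x.1 * (1 / x.2)) : ℝ) := by
        gcongr
        rw [← diag_union_offDiag]
        exact subset_union_right
    _ = N * ∑ p ∈ S, (1 / p : ℝ) + N * (∑ p ∈ S, (1 / p : ℝ)) ^ 2 := by
        rw [sq, sum_mul_sum, ← sum_product', mul_sum, mul_sum]

theorem turan_kubilius (hS : (S : Set ℕ).Pairwise Nat.Coprime) (N : ℕ) :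
    ∑ n ∈ Ioc 0 N, ((#{p ∈ S | p ∣ n} : ℝ) - ∑ p ∈ S, (1 / p : ℝ)) ^ 2 ≤
      (N + 2 * #S) * ∑ p ∈ S, (1 / p : ℝ) := by
  have hsecond := sum_sq_card_filter_dvd_le hS N
  have hfirst := le_sum_card_filter_dvd S N
  set A := ∑ p ∈ S, (1 / p : ℝ)
  have : 0 ≤ A := sum_nonneg fun p _ => by positivity
  calc ∑ n ∈ Ioc 0 N, ((#{p ∈ S | p ∣ n} : ℝ) - A) ^ 2
      = ∑ n ∈ Ioc 0 N, (#{p ∈ S | p ∣ n} : ℝ) ^ 2 -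
        2 * A * ∑ n ∈ Ioc 0 N, (#{p ∈ S | p ∣ n} : ℝ) + N * A ^ 2 := by
        simp only [sub_sq, sum_add_distrib, sum_sub_distrib, ← sum_mul, ← mul_sum, sum_const,
          Nat.card_Ioc, tsub_zero, nsmul_eq_mul]
        ring
    _ ≤ N * A + N * A ^ 2 - 2 * A * (N * A - #S) + N * A ^ 2 := by gcongr
    _ = (N + 2 * #S) * A := by ring

lemma norm_smul_sum_sub_sum_filter_dvd_le {𝕜 E : Type*} [RCLike 𝕜] [SeminormedAddCommGroup E]
    [NormedSpace 𝕜 E] {f : ℕ → E} (hf : ∀ n, ‖f n‖ ≤ 1)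
    (hS : (S : Set ℕ).Pairwise Nat.Coprime) (N : ℕ) :
    ‖((∑ p ∈ S, (1 / p : ℝ) : ℝ) : 𝕜) • ∑ n ∈ Ioc 0 N, f n -
        ∑ p ∈ S, ∑ n ∈ Ioc 0 N with p ∣ n, f n‖ ≤
      √(N * ((N + 2 * #S) * ∑ p ∈ S, (1 / p : ℝ))) := by
  have hTK := turan_kubilius hS N
  set A := ∑ p ∈ S, (1 / p : ℝ)
  have hcount : ∑ p ∈ S, ∑ n ∈ Ioc 0 N with p ∣ n, f n =
      ∑ n ∈ Ioc 0 N, ((#{p ∈ S | p ∣ n} : ℝ) : 𝕜) • f n := by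
    simp_rw [sum_filter]
    rw [sum_comm]
    simp_rw [← sum_filter, sum_const, RCLike.ofReal_natCast, Nat.cast_smul_eq_nsmul]
  rw [hcount, norm_sub_rev, smul_sum, ← sum_sub_distrib]
  simp_rw [← sub_smul, ← RCLike.ofReal_sub]
  refine Real.le_sqrt_of_sq_le ((sq_norm_sum_le_card_mul_sum_sq_norm _ _).trans ?_)
  rw [Nat.card_Ioc, tsub_zero]
  gcongr
  refine (sum_le_sum fun n _ => ?_).trans hTK
  rw [norm_smul, RCLike.norm_ofReal, mul_pow, sq_abs]
  exact mul_le_of_le_one_right (sq_nonneg _) (pow_le_one₀ (norm_nonneg _) (hf n))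

end TuranKubilius

section Katai

lemma sum_filter_dvd_eq_sum_Ioc_div {M : Type*} [AddCommMonoid M] {p : ℕ} (hp : 0 < p) (N : ℕ)
    (f : ℕ → M) : ∑ n ∈ Ioc 0 N with p ∣ n, f n = ∑ m ∈ Ioc 0 (N / p), f (p * m) := by
  symm
  refine sum_nbij (p * ·) (fun m hm => ?_) (mul_right_injective₀ hp.ne').injOn (fun n hn => ?_)
    fun _ _ => rfl
  · rw [mem_Ioc, Nat.le_div_iff_mul_le hp, mul_comm] at hm
    exact mem_filter.mpr ⟨mem_Ioc.mpr ⟨Nat.mul_pos hp hm.1, hm.2⟩, dvd_mul_right p m⟩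
  · obtain ⟨hn, m, rfl⟩ := mem_filter.mp hn
    obtain ⟨hn0, hnN⟩ := mem_Ioc.mp hn
    rw [mul_comm] at hnN
    exact ⟨m, mem_Ioc.mpr ⟨pos_of_mul_pos_right hn0 hp.le, (Nat.le_div_iff_mul_le hp).mpr hnN⟩, rfl⟩

lemma norm_sum_map_mul_sub_smul_le {𝕜 E : Type*} [NormedField 𝕜] [SeminormedAddCommGroup E]
    [NormedSpace 𝕜 E] {ν : ArithmeticFunction 𝕜} (hν : ν.IsMultiplicative)
    (hν1 : ∀ n, ‖ν n‖ ≤ 1) {G : ℕ → E} (hG : ∀ n, ‖G n‖ ≤ 1) {p : ℕ} (hp : p.Prime) (M : ℕ) :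
    ‖∑ m ∈ Ioc 0 M, (ν (p * m) - ν p * ν m) • G m‖ ≤ 2 * (M / p) := by
  have hterm : ∀ m ∈ Ioc 0 M, ‖(ν (p * m) - ν p * ν m) • G m‖ ≤ if p ∣ m then 2 else 0 := by
    intro m _
    split_ifs with h
    · rw [norm_smul, ← one_add_one_eq_two]
      refine (mul_le_of_le_one_right (norm_nonneg _) (hG m)).trans (norm_sub_le_of_le (hν1 _) ?_)
      rw [norm_mul]
      exact mul_le_one₀ (hν1 p) (norm_nonneg _) (hν1 m)
    · rw [hν.map_mul_of_coprime (hp.coprime_iff_not_dvd.mpr h), sub_self, zero_smul, norm_zero]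
  calc ‖∑ m ∈ Ioc 0 M, (ν (p * m) - ν p * ν m) • G m‖
      ≤ ∑ m ∈ Ioc 0 M, if p ∣ m then 2 else 0 := norm_sum_le_of_le _ hterm
    _ = 2 * #{m ∈ Ioc 0 M | p ∣ m} := by
        rw [← sum_filter, sum_const, nsmul_eq_mul, mul_comm]
    _ ≤ 2 * (M / p) := by
        gcongr
        exact card_filter_dvd_le M p

lemma sqrt_add_le_sqrt_add_sqrt {x y : ℝ} (hx : 0 ≤ x) (hy : 0 ≤ y) : √(x + y) ≤ √x + √y := by
  refine Real.sqrt_le_iff.mpr ⟨by positivity, ?_⟩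
  rw [add_sq, Real.sq_sqrt hx, Real.sq_sqrt hy]
  linarith [mul_nonneg (Real.sqrt_nonneg x) (Real.sqrt_nonneg y)]

lemma tendsto_const_mul_sqrt_add_const_div (a b : ℝ) :
    Tendsto (fun x : ℝ => (a * √x + b) / x) atTop (𝓝 0) := by
  have h := ((Real.tendsto_sqrt_atTop.inv_tendsto_atTop).const_mul a).add
    (tendsto_inv_atTop_zero.const_mul b)
  simp only [mul_zero, add_zero] at h
  refine h.congr fun x => ?_
  rw [Pi.inv_apply, ← Real.sqrt_div_self]
  ring

lemma tendsto_sum_primesBelow_one_div :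
    Tendsto (fun n : ℕ => ∑ p ∈ n.primesBelow, (1 / p : ℝ)) atTop atTop := by
  have h := (not_summable_iff_tendsto_nat_atTop_of_nonneg
    (Set.indicator_nonneg fun n _ => by positivity)).mp not_summable_one_div_on_primes
  refine h.congr fun n => ?_
  rw [Nat.primesBelow, sum_filter]
  simp only [Set.indicator_apply, Set.mem_ofPred_eq]

variable {𝕜 E : Type*} [RCLike 𝕜] [SeminormedAddCommGroup E] [InnerProductSpace 𝕜 E]

lemma sq_norm_sum_sum_Ioc_smul_le {ι : Type*} {S : Finset ι} {M : ι → ℕ} {N : ℕ}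
    (hM : ∀ i ∈ S, M i ≤ N) {a : ℕ → 𝕜} (ha : ∀ m, ‖a m‖ ≤ 1) (G : ι → ℕ → E) :
    ‖∑ i ∈ S, ∑ m ∈ Ioc 0 (M i), a m • G i m‖ ^ 2 ≤
      N * ∑ i ∈ S, ∑ j ∈ S, ‖∑ m ∈ Ioc 0 (min (M i) (M j)), ⟪G i m, G j m⟫_𝕜‖ := by
  set H : ℕ → ι → E := fun m i => if m ≤ M i then G i m else 0 with hH
  have hfilter : ∀ L ≤ N, {m ∈ Ioc 0 N | m ≤ L} = Ioc 0 L := fun L hL => by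
    ext m
    simp only [mem_filter, mem_Ioc]
    omega
  have hswap : ∑ i ∈ S, ∑ m ∈ Ioc 0 (M i), a m • G i m =
      ∑ m ∈ Ioc 0 N, a m • ∑ i ∈ S, H m i := by
    simp_rw [smul_sum]
    rw [sum_comm]
    refine sum_congr rfl fun i hi => ?_
    rw [← hfilter (M i) (hM i hi), sum_filter]
    simp only [hH, smul_ite, smul_zero]
  have hinner : ∀ i ∈ S, ∀ j, ∑ m ∈ Ioc 0 N, ⟪H m i, H m j⟫_𝕜 =
      ∑ m ∈ Ioc 0 (min (M i) (M j)), ⟪G i m, G j m⟫_𝕜 := fun i hi j => by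
    rw [← hfilter _ (min_le_of_left_le (hM i hi)), sum_filter]
    refine sum_congr rfl fun m _ => ?_
    by_cases h : m ≤ M i <;> by_cases h' : m ≤ M j <;> simp [hH, h, h']
  calc ‖∑ i ∈ S, ∑ m ∈ Ioc 0 (M i), a m • G i m‖ ^ 2
      ≤ N * ∑ m ∈ Ioc 0 N, ‖a m • ∑ i ∈ S, H m i‖ ^ 2 := by
        rw [hswap]
        simpa using sq_norm_sum_le_card_mul_sum_sq_norm (Ioc 0 N) fun m => a m • ∑ i ∈ S, H m i
    _ ≤ N * ∑ m ∈ Ioc 0 N, ‖∑ i ∈ S, H m i‖ ^ 2 := by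
        gcongr with m _
        rw [norm_smul]
        exact mul_le_of_le_one_left (norm_nonneg _) (ha m)
    _ ≤ N * ∑ i ∈ S, ∑ j ∈ S, ‖∑ m ∈ Ioc 0 N, ⟪H m i, H m j⟫_𝕜‖ := by
        gcongr
        exact sum_sq_norm_sum_le _ _ _
    _ = _ := by
        congr 1
        exact sum_congr rfl fun i hi => sum_congr rfl fun j _ => by rw [hinner i hi j]

variable (𝕜) in
/-- The off-diagonal term of Kátai's inequality: the total correlation, up to `N`, between the
dilates `F (p ·)` and `F (q ·)` over ordered pairs of distinct `p, q ∈ S`. -/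
noncomputable def dilateCorrelation (F : ℕ → E) (S : Finset ℕ) (N : ℕ) : ℝ :=
  ∑ x ∈ S.offDiag, ‖∑ m ∈ Ioc 0 (min (N / x.1) (N / x.2)), ⟪F (x.1 * m), F (x.2 * m)⟫_𝕜‖

variable {F : ℕ → E}

lemma dilateCorrelation_nonneg (F : ℕ → E) (S : Finset ℕ) (N : ℕ) :
    0 ≤ dilateCorrelation 𝕜 F S N :=
  sum_nonneg fun _ _ => norm_nonneg _

lemma tendsto_dilateCorrelation_div {S : Finset ℕ} (hS : ∀ p ∈ S, p ≠ 0)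
    (hcorr : ∀ p ∈ S, ∀ q ∈ S, p ≠ q → Tendsto (fun N : ℕ =>
      ‖∑ m ∈ Ioc 0 N, ⟪F (p * m), F (q * m)⟫_𝕜‖ / N) atTop (𝓝 0)) :
    Tendsto (fun N : ℕ => dilateCorrelation 𝕜 F S N / N) atTop (𝓝 0) := by
  simp only [dilateCorrelation, sum_div]
  suffices h : ∀ x ∈ S.offDiag, Tendsto (fun N : ℕ => ‖∑ m ∈ Ioc 0 (min (N / x.1) (N / x.2)),
      ⟪F (x.1 * m), F (x.2 * m)⟫_𝕜‖ / N) atTop (𝓝 0) by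
    simpa only [sum_const_zero] using tendsto_finsetSum S.offDiag h
  intro x hx
  obtain ⟨hp, hq, hpq⟩ := mem_offDiag.mp hx
  have hmin : Tendsto (fun N => min (N / x.1) (N / x.2)) atTop atTop :=
    tendsto_inf_atTop _ (Nat.tendsto_div_const_atTop (hS _ hp))
      (Nat.tendsto_div_const_atTop (hS _ hq))
  refine squeeze_zero' (.of_forall fun N => by positivity) ?_ ((hcorr _ hp _ hq hpq).comp hmin)
  filter_upwards [hmin.eventually_gt_atTop 0] with N hN
  simp only [Function.comp_apply]
  gcongr
  exact min_le_of_left_le (Nat.div_le_self _ _)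

lemma sum_sum_norm_sum_inner_dilate_le (hF : ∀ n, ‖F n‖ ≤ 1) (S : Finset ℕ) (N : ℕ) :
    ∑ p ∈ S, ∑ q ∈ S, ‖∑ m ∈ Ioc 0 (min (N / p) (N / q)), ⟪F (p * m), F (q * m)⟫_𝕜‖ ≤
      N * ∑ p ∈ S, (1 / p : ℝ) + dilateCorrelation 𝕜 F S N := by
  rw [sum_sum_eq_sum_add_sum_offDiag, mul_sum]
  refine add_le_add_left (sum_le_sum fun p _ => ?_) _
  calc ‖∑ m ∈ Ioc 0 (min (N / p) (N / p)), ⟪F (p * m), F (p * m)⟫_𝕜‖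
      ≤ ∑ _ ∈ Ioc 0 (N / p), (1 : ℝ) := by
        rw [min_self]
        exact norm_sum_le_of_le _ fun m _ => norm_inner_le_one (hF _) (hF _)
    _ = (N / p : ℕ) := by simp
    _ ≤ N * (1 / p) := by
        rw [mul_one_div]
        exact Nat.cast_div_le

variable {ν : ArithmeticFunction 𝕜}

lemma norm_sum_sum_filter_dvd_smul_le (hν : ν.IsMultiplicative) (hν1 : ∀ n, ‖ν n‖ ≤ 1)
    (hF : ∀ n, ‖F n‖ ≤ 1) {S : Finset ℕ} (hS : ∀ p ∈ S, p.Prime) (N : ℕ) :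
    ‖∑ p ∈ S, ∑ n ∈ Ioc 0 N with p ∣ n, ν n • F n‖ ≤
      2 * N * ∑ p ∈ S, 1 / (p : ℝ) ^ 2 +
      √(N * (N * ∑ p ∈ S, (1 / p : ℝ) + dilateCorrelation 𝕜 F S N)) := by
  have hsplit : ∑ p ∈ S, ∑ n ∈ Ioc 0 N with p ∣ n, ν n • F n =
      ∑ p ∈ S, ∑ m ∈ Ioc 0 (N / p), (ν (p * m) - ν p * ν m) • F (p * m) +
      ∑ p ∈ S, ∑ m ∈ Ioc 0 (N / p), ν m • ν p • F (p * m) := by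
    rw [← sum_add_distrib]
    refine sum_congr rfl fun p hp => ?_
    rw [sum_filter_dvd_eq_sum_Ioc_div (hS p hp).pos, ← sum_add_distrib]
    refine sum_congr rfl fun m _ => ?_
    rw [smul_smul, mul_comm (ν m), ← add_smul, sub_add_cancel]
  rw [hsplit]
  refine norm_add_le_of_le ?_ (Real.le_sqrt_of_sq_le ?_)
  · rw [mul_sum]
    refine norm_sum_le_of_le _ fun p hp => ?_
    refine (norm_sum_map_mul_sub_smul_le hν hν1 (fun m => hF (p * m)) (hS p hp) _).trans ?_
    rw [mul_assoc, sq, ← div_eq_mul_one_div, ← div_div]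
    gcongr
    exact Nat.cast_div_le
  · refine (sq_norm_sum_sum_Ioc_smul_le (fun p _ => Nat.div_le_self N p) hν1
      fun p m => ν p • F (p * m)).trans ?_
    gcongr
    refine le_trans ?_ (sum_sum_norm_sum_inner_dilate_le hF S N)
    gcongr with p _ q _
    simp_rw [inner_smul_left, inner_smul_right, ← mul_sum, norm_mul, RCLike.norm_conj]
    exact mul_le_of_le_one_left (by positivity) (hν1 p) |>.trans <|
      mul_le_of_le_one_left (norm_nonneg _) (hν1 q)

lemma katai_inequality (hν : ν.IsMultiplicative) (hν1 : ∀ n, ‖ν n‖ ≤ 1) (hF : ∀ n, ‖F n‖ ≤ 1)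
    {S : Finset ℕ} (hS : ∀ p ∈ S, p.Prime) (N : ℕ) :
    (∑ p ∈ S, (1 / p : ℝ)) * ‖∑ n ∈ Ioc 0 N, ν n • F n‖ ≤
      √(N * ((N + 2 * #S) * ∑ p ∈ S, (1 / p : ℝ))) + 2 * N * ∑ p ∈ S, 1 / (p : ℝ) ^ 2 +
      √(N * (N * ∑ p ∈ S, (1 / p : ℝ) + dilateCorrelation 𝕜 F S N)) := by
  have hcoprime : (S : Set ℕ).Pairwise Nat.Coprime := fun p hp q hq hpq =>
    (Nat.coprime_primes (hS p hp) (hS q hq)).mpr hpq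
  have hνF : ∀ n, ‖ν n • F n‖ ≤ 1 := fun n => by
    rw [norm_smul]
    exact mul_le_one₀ (hν1 n) (norm_nonneg _) (hF n)
  have hTK := norm_smul_sum_sub_sum_filter_dvd_le (𝕜 := 𝕜) hνF hcoprime N
  have hmultiples := norm_sum_sum_filter_dvd_smul_le hν hν1 hF hS N
  calc (∑ p ∈ S, (1 / p : ℝ)) * ‖∑ n ∈ Ioc 0 N, ν n • F n‖
      = ‖((∑ p ∈ S, (1 / p : ℝ) : ℝ) : 𝕜) • ∑ n ∈ Ioc 0 N, ν n • F n‖ := by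
        rw [norm_smul, RCLike.norm_ofReal, abs_of_nonneg (by positivity)]
    _ ≤ _ := norm_le_norm_add_norm_sub' _ _
    _ ≤ _ := add_le_add hmultiples hTK
    _ = _ := by ring

lemma norm_sum_smul_div_le (hν : ν.IsMultiplicative) (hν1 : ∀ n, ‖ν n‖ ≤ 1) (hF : ∀ n, ‖F n‖ ≤ 1)
    {S : Finset ℕ} (hS : ∀ p ∈ S, p.Prime) (hS0 : 0 < ∑ p ∈ S, (1 / p : ℝ)) {N : ℕ}
    (hN : 0 < N) :
    ‖∑ n ∈ Ioc 0 N, ν n • F n‖ / N ≤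
      (2 * √(∑ p ∈ S, (1 / p : ℝ)) + 2 * ∑ p ∈ S, 1 / (p : ℝ) ^ 2) / ∑ p ∈ S, (1 / p : ℝ) +
      (√(2 * #S * (∑ p ∈ S, (1 / p : ℝ)) / N) + √(dilateCorrelation 𝕜 F S N / N)) /
        ∑ p ∈ S, (1 / p : ℝ) := by
  have hkatai := katai_inequality hν hν1 hF hS N
  set A := ∑ p ∈ S, (1 / p : ℝ)
  have hN' : (0 : ℝ) < N := by exact_mod_cast hN
  have hsqrt : ∀ x : ℝ, 0 ≤ x → √(N * (N * A + x)) ≤ N * (√A + √(x / N)) := fun x hx => by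
    rw [show N * (N * A + x) = (N : ℝ) ^ 2 * (A + x / N) by field_simp,
      Real.sqrt_mul (by positivity), Real.sqrt_sq hN'.le]
    gcongr
    exact sqrt_add_le_sqrt_add_sqrt hS0.le (by positivity)
  have hvariance := hsqrt (2 * #S * A) (by positivity)
  have hcorrelation := hsqrt _ (dilateCorrelation_nonneg (𝕜 := 𝕜) F S N)
  rw [← add_mul] at hvariance
  rw [← add_div, div_le_div_iff₀ hN' hS0]
  linarith

theorem katai_criterion (hν : ν.IsMultiplicative) (hν1 : ∀ n, ‖ν n‖ ≤ 1) (hF : ∀ n, ‖F n‖ ≤ 1)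
    (hcorr : ∀ p q : ℕ, p.Prime → q.Prime → p ≠ q → Tendsto (fun N : ℕ =>
      ‖∑ m ∈ Ioc 0 N, ⟪F (p * m), F (q * m)⟫_𝕜‖ / N) atTop (𝓝 0)) :
    Tendsto (fun N : ℕ => ‖∑ n ∈ Ioc 0 N, ν n • F n‖ / N) atTop (𝓝 0) := by
  have hsummable : Summable fun n : ℕ => 1 / (n : ℝ) ^ 2 :=
    Real.summable_one_div_nat_pow.mpr one_lt_two
  set B := ∑' n : ℕ, 1 / (n : ℝ) ^ 2
  refine tendsto_zero_of_forall_le_add (.of_forall fun N => by positivity) fun ε hε => ?_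
  obtain ⟨n, hn, hn0⟩ := (tendsto_sum_primesBelow_one_div.eventually
    (((tendsto_const_mul_sqrt_add_const_div 2 (2 * B)).eventually_le_const hε).and
      (eventually_gt_atTop 0))).exists
  set S := n.primesBelow
  have hS : ∀ p ∈ S, p.Prime := fun p => Nat.prime_of_mem_primesBelow
  set A := ∑ p ∈ S, (1 / p : ℝ)
  have hB : ∑ p ∈ S, 1 / (p : ℝ) ^ 2 ≤ B := hsummable.sum_le_tsum S fun _ _ => by positivity
  refine ⟨fun N => (√(2 * #S * A / N) + √(dilateCorrelation 𝕜 F S N / N)) / A, ?_, ?_⟩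
  · have hR := tendsto_dilateCorrelation_div (fun p hp => (hS p hp).ne_zero)
      fun p hp q hq => hcorr p q (hS p hp) (hS q hq)
    simpa using ((tendsto_const_div_atTop_nhds_zero_nat (2 * #S * A)).sqrt.add
      hR.sqrt).div_const A
  filter_upwards [eventually_gt_atTop 0] with N hN
  refine (norm_sum_smul_div_le hν hν1 hF hS hn0 hN).trans ?_
  gcongr
  refine le_trans ?_ hn
  gcongr

end Katai

section Blocks

lemma slowlyVarying_comp_of_monotone {E : Type*} [SeminormedAddCommGroup E] {κ : ℕ → ℕ}
    (hκ : Monotone κ) (hκ0 : Tendsto (fun N : ℕ => (κ N / N : ℝ)) atTop (𝓝 0)) {c : ℕ → E}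
    (hc : ∀ k, ‖c k‖ ≤ 1) : SlowlyVarying fun n => c (κ n) := by
  have hstep : ∀ n, ‖c (κ (n + 1)) - c (κ n)‖ ≤ 2 * ((κ (n + 1) : ℝ) - κ n) := fun n => by
    rcases (hκ n.le_succ).eq_or_lt with h | h
    · simp [← h]
    · have hjump : (κ n : ℝ) + 1 ≤ κ (n + 1) := by exact_mod_cast h
      linarith [norm_sub_le_of_le (hc (κ (n + 1))) (hc (κ n))]
  refine squeeze_zero (fun N => by positivity) (fun N => ?_) (by simpa using hκ0.const_mul 2)
  rw [mul_div_assoc']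
  gcongr
  calc ∑ n ∈ range N, ‖c (κ (n + 1)) - c (κ n)‖
      ≤ ∑ n ∈ range N, 2 * ((κ (n + 1) : ℝ) - κ n) := sum_le_sum fun n _ => hstep n
    _ = 2 * ((κ N : ℝ) - κ 0) := by rw [← mul_sum, sum_range_sub fun n => (κ n : ℝ)]
    _ ≤ 2 * κ N := by linarith [(κ 0).cast_nonneg (α := ℝ)]

/-- The index `k` of the block `[b k, b (k + 1))` containing `n`, for strictly increasing `b`; it
is `0` when `n < b 0`. Sequences constant on blocks are those factoring through it. -/
def blockIndex (b : ℕ → ℕ) (n : ℕ) : ℕ := Nat.findGreatest (b · ≤ n) n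

variable {b : ℕ → ℕ}

lemma blockIndex_mono (b : ℕ → ℕ) : Monotone (blockIndex b) := fun _ _ h =>
  Nat.findGreatest_mono (fun _ hk => le_trans hk h) h

lemma blockIndex_eq_of_mem_Ico (hb : StrictMono b) {k n : ℕ} (hn : n ∈ Ico (b k) (b (k + 1))) :
    blockIndex b n = k := by
  obtain ⟨hkn, hnk⟩ := mem_Ico.mp hn
  refine Nat.findGreatest_eq_iff.mpr ⟨hb.le_apply.trans hkn, fun _ => hkn, fun j hkj _ => ?_⟩
  exact not_le.mpr (hnk.trans_le (hb.monotone hkj))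

lemma mul_blockIndex_le {G K : ℕ} (hG : ∀ k ≥ K, G ≤ (b (k + 1) : ℤ) - b k) (n : ℕ) :
    G * blockIndex b n ≤ n + G * K := by
  have hgrowth : ∀ j, G * j ≤ b (K + j) := fun j => by
    induction j with
    | zero => simp
    | succ j ih =>
      have := hG (K + j) (Nat.le_add_right K j)
      rw [mul_add_one, ← add_assoc]
      omega
  rcases le_or_gt (blockIndex b n) K with h | h
  · exact (Nat.mul_le_mul_left G h).trans (Nat.le_add_left _ _)
  · obtain ⟨j, hj⟩ := Nat.exists_eq_add_of_le h.le
    have hle : b (blockIndex b n) ≤ n :=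
      Nat.findGreatest_of_ne_zero (P := (b · ≤ n)) rfl (Nat.ne_zero_of_lt h)
    rw [hj] at hle ⊢
    rw [mul_add, add_comm]
    gcongr
    exact (hgrowth j).trans hle

lemma tendsto_blockIndex_div
    (hgap : Tendsto (fun k : ℕ => (b (k + 1) : ℤ) - (b k : ℤ)) atTop atTop) :
    Tendsto (fun n : ℕ => (blockIndex b n / n : ℝ)) atTop (𝓝 0) := by
  refine tendsto_zero_of_forall_le_add (.of_forall fun n => by positivity) fun ε hε => ?_
  obtain ⟨G, hGε⟩ := exists_nat_one_div_lt hε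
  obtain ⟨K, hK⟩ := eventually_atTop.mp (hgap.eventually_ge_atTop ((G + 1 : ℕ) : ℤ))
  refine ⟨fun n => K / n, tendsto_const_div_atTop_nhds_zero_nat _, ?_⟩
  filter_upwards [eventually_gt_atTop 0] with n hn
  have hn' : (0 : ℝ) < n := by exact_mod_cast hn
  have hmul : ((G + 1 : ℝ)) * blockIndex b n ≤ n + (G + 1) * K := by
    exact_mod_cast mul_blockIndex_le hK n
  refine le_trans ?_ (add_le_add_left hGε.le _)
  rw [div_add_div _ _ (by positivity) hn'.ne', div_le_div_iff₀ hn' (by positivity)]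
  nlinarith

lemma sum_range_sum_Ico {M : Type*} [AddCommMonoid M] (hb : Monotone b) (f : ℕ → M) (K : ℕ) :
    ∑ k ∈ range K, ∑ n ∈ Ico (b k) (b (k + 1)), f n = ∑ n ∈ Ico (b 0) (b K), f n := by
  induction K with
  | zero => simp
  | succ K ih =>
    rw [sum_range_succ, ih, sum_Ico_consecutive _ (hb K.zero_le) (hb K.le_succ)]

variable {𝕜 : Type*} [RCLike 𝕜]

lemma tendsto_norm_sum_inner_smul_dilate {E : Type*} [SeminormedAddCommGroup E]
    [InnerProductSpace 𝕜 E] {w : ℕ → 𝕜} (hw : SlowlyVarying w) (hw1 : ∀ n, ‖w n‖ ≤ 1)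
    {F : ℕ → E} (hF : ∀ n, ‖F n‖ ≤ 1) {p q : ℕ} (hp : 0 < p) (hq : 0 < q)
    (hcorr : HasUniformMeanZero fun n => ⟪F (p * n), F (q * n)⟫_𝕜) :
    Tendsto (fun N : ℕ => ‖∑ m ∈ Ioc 0 N,
      ⟪w (p * m) • F (p * m), w (q * m) • F (q * m)⟫_𝕜‖ / N) atTop (𝓝 0) := by
  have hwpq : SlowlyVarying fun n => w (q * n) * star (w (p * n)) :=
    (hw.comp_mul hq).mul (hw.comp_mul hp).star (fun _ => hw1 _)
      fun _ => (norm_star _).trans_le (hw1 _)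
  have hwpq1 : ∀ n, ‖w (q * n) * star (w (p * n))‖ ≤ 1 := fun n => by
    rw [norm_mul, norm_star]
    exact mul_le_one₀ (hw1 _) (norm_nonneg _) (hw1 _)
  simpa only [inner_smul_left, inner_smul_right, smul_eq_mul, mul_assoc, starRingEnd_apply] using
    hwpq.tendsto_norm_sum_Ioc_smul hwpq1 hcorr fun _ => norm_inner_le_one (hF _) (hF _)

lemma tendsto_norm_sum_Ico_div {E : Type*} [SeminormedAddCommGroup E] {f : ℕ → E}
    (hf1 : ∀ n, ‖f n‖ ≤ 1)
    (hf : Tendsto (fun N : ℕ => ‖∑ n ∈ Ioc 0 N, f n‖ / N) atTop (𝓝 0)) (m : ℕ) :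
    Tendsto (fun N : ℕ => ‖∑ n ∈ Ico m N, f n‖ / N) atTop (𝓝 0) := by
  have h := hf.add (tendsto_const_div_atTop_nhds_zero_nat (2 + m : ℝ))
  rw [add_zero] at h
  refine squeeze_zero' (.of_forall fun N => by positivity) ?_ h
  filter_upwards [eventually_ge_atTop m] with N hN
  rw [← add_div, ← add_assoc, sum_Ico_eq_sub f hN, sum_Ioc_zero_eq_sum_range]
  gcongr
  refine norm_sub_le_of_le ?_ (norm_sum_range_le_of_norm_le_one hf1 m)
  refine (norm_le_norm_add_norm_sub' _ (∑ n ∈ range N, f (n + 1))).trans ?_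
  gcongr
  simpa using norm_sum_range_sub_sum_shift_le hf1 N 1

theorem tendsto_sum_norm_sum_Ico_mul_div {ν : ArithmeticFunction 𝕜} (hν : ν.IsMultiplicative)
    (hν1 : ∀ n, ‖ν n‖ ≤ 1) (hb : StrictMono b)
    (hgap : Tendsto (fun k : ℕ => (b (k + 1) : ℤ) - (b k : ℤ)) atTop atTop)
    {F : ℕ → 𝕜} (hF : ∀ n, ‖F n‖ ≤ 1)
    (hcorr : ∀ p q : ℕ, p.Prime → q.Prime → p ≠ q →
      HasUniformMeanZero fun n => ⟪F (p * n), F (q * n)⟫_𝕜) :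
    Tendsto (fun K : ℕ => (∑ k ∈ range K, ‖∑ n ∈ Ico (b k) (b (k + 1)), F n * ν n‖) / b K)
      atTop (𝓝 0) := by
  choose c hc1 hc using fun k =>
    RCLike.exists_norm_eq_mul_self (∑ n ∈ Ico (b k) (b (k + 1)), F n * ν n)
  set w : ℕ → 𝕜 := fun n => c (blockIndex b n) with hw
  have hw1 : ∀ n, ‖w n‖ ≤ 1 := fun n => (hc1 _).le
  have hwF : ∀ n, ‖w n • F n‖ ≤ 1 := fun n => by
    rw [norm_smul]
    exact mul_le_one₀ (hw1 n) (norm_nonneg _) (hF n)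
  have hνwF : ∀ n, ‖ν n • w n • F n‖ ≤ 1 := fun n => by
    rw [norm_smul]
    exact mul_le_one₀ (hν1 n) (norm_nonneg _) (hwF n)
  have hslow : SlowlyVarying w :=
    slowlyVarying_comp_of_monotone (blockIndex_mono b) (tendsto_blockIndex_div hgap)
      fun k => (hc1 k).le
  have hkatai := katai_criterion hν hν1 hwF fun p q hp hq hpq =>
    tendsto_norm_sum_inner_smul_dilate hslow hw1 hF hp.pos hq.pos (hcorr p q hp hq hpq)
  have hblocks : ∀ K, ∑ n ∈ Ico (b 0) (b K), ν n • w n • F n =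
      ((∑ k ∈ range K, ‖∑ n ∈ Ico (b k) (b (k + 1)), F n * ν n‖ : ℝ) : 𝕜) := fun K => by
    rw [← sum_range_sum_Ico hb.monotone, RCLike.ofReal_sum]
    refine sum_congr rfl fun k _ => ?_
    rw [hc, mul_sum]
    refine sum_congr rfl fun n hn => ?_
    simp only [hw, blockIndex_eq_of_mem_Ico hb hn, smul_eq_mul]
    ring
  refine ((tendsto_norm_sum_Ico_div hνwF hkatai (b 0)).comp hb.tendsto_atTop).congr fun K => ?_
  rw [Function.comp_apply, hblocks, RCLike.norm_ofReal, abs_of_nonneg (by positivity)]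

end Blocks

theorem theorem4
    (ν : ArithmeticFunction ℂ) (hν : ν.IsMultiplicative) (hν1 : ∀ n : ℕ, 1 ≤ n → ‖ν n‖ ≤ 1)
    (b : ℕ → ℕ) (hb1 : b 1 = 1) (hb : ∀ k : ℕ, 1 ≤ k → b k < b (k + 1))
    (hgap : Filter.Tendsto (fun k : ℕ => (b (k + 1) : ℤ) - (b k : ℤ)) Filter.atTop Filter.atTop)
    (P : Polynomial ℝ) (hdeg : 0 < P.natDegree) (hP : Irrational P.leadingCoeff) :
    Filter.Tendsto
      (fun K : ℕ => (1 / (b (K + 1) : ℝ)) *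
        ∑ k ∈ Finset.Icc 1 K,
          ‖∑ n ∈ Finset.Ico (b k) (b (k + 1)),
            Complex.exp (2 * (Real.pi : ℂ) * Complex.I * ((P.eval (n : ℝ) : ℝ) : ℂ)) * ν n‖)
      Filter.atTop (nhds 0) := by
  have hν1' : ∀ n, ‖ν n‖ ≤ 1 := fun n => by
    rcases n.eq_zero_or_pos with rfl | hn
    · simp
    · exact hν1 n hn
  have hphase : ∀ x : ℝ, Complex.exp (2 * Real.pi * Complex.I * x) = 𝐞 x := fun x => by
    rw [Real.fourierChar_apply]
    push_cast
    ring_nf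
  have hb_shift : StrictMono fun k => b (k + 1) :=
    strictMono_nat_of_lt_succ fun k => hb (k + 1) k.succ_pos
  have hblocks := tendsto_sum_norm_sum_Ico_mul_div hν hν1' hb_shift
    ((tendsto_add_atTop_iff_nat 1).mpr hgap)
    (F := fun n => (𝐞 (P.eval (n : ℝ)) : ℂ)) (fun n => (norm_fourierChar _).le)
    fun p q hp hq hpq =>
      hasUniformMeanZero_inner_fourierChar_eval_mul hdeg hP hp.ne_zero hq.ne_zero hpq
  refine hblocks.congr fun K => ?_
  rw [one_div_mul_eq_div, show Icc 1 K = Ioc 0 K from Icc_add_one_left_eq_Ioc 0 K,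
    sum_Ioc_zero_eq_sum_range]
  simp only [hphase]
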